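/- Let $d\ge 2$ and $k\ge 0$ be integers and let $G$ be the rooted tree of height $k$ in which every vertex at level $i<k$ has exactly $d$ children at level $i+1$; level $0$ consists of the root $v$ (the source), and level $k$ has $n=d^k$ vertices, each joined to an additional sink vertex $z$. Diffusion limited aggregation (DLA) on $G$ is the following process. Initially only $z$ is occupied. At each step $t=1,2,\dots$ a particle is released at $v$ and moves down the tree: at a vertex $u$ of level $i<k$ it chooses a child $w$ of $u$ uniformly at random, independently of everything else; if $w$ is unoccupied it moves to $w$, and if $w$ is occupied it halts at $u$, which becomes occupied. A particle that reaches level $k$ halts there and occupies that vertex. The finish time $t_f$ is the first step at the end of which $v$ is occupied. Put $$T=T(d,k)=\sqrt{k}\;d^{\,k+3/2-\sqrt{2k+2}} .$$ Let $(d_m,k_m)_{m\ge 0}$ be any sequence of such parameters with $n_m=d_m^{k_m}\to\infty$, let $(\omega_m)$ be any real sequence with $\omega_m\to\infty$, and let "w.h.p." mean with probability tending to $1$ as $m\to\infty$ (we suppress the index $m$). 1. Suppose that for some constant $B$, for every $m$, either $d^{1/\sqrt k}\le B$ or $2k+2$ is a perfect square. (The first alternative holds in particular if $d$ is constant; for $k=0$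 read $1/\sqrt{k}$ as $0$.) Then w.h.p. $$\frac{T}{\omega}\;\le\; t_f\;\le\;\omega\, d^{1/2}\,T .$$ 2. There is an absolute constant $A>0$ such that, for all sequences $(d_m,k_m)$ and $(\omega_m)$ as above, w.h.p. $$\frac{T}{\omega\, d^{A/\sqrt{k}}}\;\le\; t_f\;\le\;\omega\, d^{1/2}\,T .$$ -/

import Mathlib

open MeasureTheory ProbabilityTheory Filter Topology

namespace DLA

/-- A vertex at level `i` of the rooted tree with branching factor `d` is a word of length `i`
over `Fin d`: the source is `[]`, and the children of `u` are the words `u ++ [a]`. -/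
abbrev Vertex (d : ℕ) := List (Fin d)

/-- A directed path from the source to level `k`, recorded by the child chosen at each level. -/
abbrev Walk (d k : ℕ) := Fin k → Fin d

/-- The vertex at which a particle halts if it is at `u`, the set of occupied vertices is `C`,
and `r` lists the children it chooses on its way down to the last level. A particle whose chosen
child is occupied halts where it is; a particle at the last level (`r = []`) halts there, because
the only vertex ahead of it is the sink, which is always occupied. -/
def halt {d : ℕ} (C : Finset (Vertex d)) : Vertex d → List (Fin d) → Vertex d
  | u, [] => u
  | u, a :: r => if u ++ [a] ∈ C then u else halt C (u ++ [a]) r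

/-- One step of the process: release a particle at the source and let it occupy the vertex at
which it halts. Nothing happens any more once the source is occupied. -/
def step {d k : ℕ} (C : Finset (Vertex d)) (w : Walk d k) : Finset (Vertex d) :=
  if [] ∈ C then C else insert (halt C [] (List.ofFn w)) C

/-- The set of occupied vertices (other than the sink) at the end of step `t`, where the
`(s + 1)`-st particle follows the walk `ρ s`. -/
def occupied {d k : ℕ} (ρ : ℕ → Walk d k) : ℕ → Finset (Vertex d)
  | 0 => ∅
  | t + 1 => step (occupied ρ t) (ρ t)

theorem halt_notMem {d : ℕ} (C : Finset (Vertex d)) (r : List (Fin d)) :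
    ∀ u : Vertex d, u ∉ C → halt C u r ∉ C := by
  induction r with
  | nil => intro u hu; simpa [halt] using hu
  | cons a r ih =>
    intro u hu
    by_cases h : u ++ [a] ∈ C
    · simpa [halt, h] using hu
    · simpa [halt, h] using ih _ h

theorem length_halt_le {d : ℕ} (C : Finset (Vertex d)) (r : List (Fin d)) :
    ∀ u : Vertex d, (halt C u r).length ≤ u.length + r.length := by
  induction r with
  | nil => intro u; simp [halt]
  | cons a r ih =>
    intro u
    by_cases h : u ++ [a] ∈ C
    · simp [halt, h]
    · have := ih (u ++ [a])
      simp only [halt, h, if_false, List.length_append, List.length_cons, List.length_nil] at this ⊢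
      omega

/-- The source is eventually occupied, whatever the walks are. -/
theorem exists_source_mem_occupied {d k : ℕ} (ρ : ℕ → Walk d k) :
    ∃ t, ([] : Vertex d) ∈ occupied ρ t := by
  by_contra! hne
  have hcard : ∀ t, (occupied ρ t).card = t := by
    intro t
    induction t with
    | zero => simp [occupied]
    | succ t ih =>
      rw [occupied, step, if_neg (hne t), Finset.card_insert_of_notMem (halt_notMem _ _ _ (hne t)),
        ih]
  have hlen : ∀ t, ∀ u ∈ occupied ρ t, u.length ≤ k := by
    intro t
    induction t with
    | zero => simp [occupied]
    | succ t ih =>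
      intro u hu
      rw [occupied, step, if_neg (hne t), Finset.mem_insert] at hu
      rcases hu with rfl | hu
      · simpa using length_halt_le (occupied ρ t) (List.ofFn (ρ t)) []
      · exact ih u hu
  have hfin : {u : Vertex d | u.length ≤ k}.Finite := List.finite_length_le (Fin d) k
  have hle := Finset.card_le_card (s := occupied ρ (hfin.toFinset.card + 1)) (t := hfin.toFinset)
    (fun u hu => by simpa using hlen _ u hu)
  rw [hcard] at hle
  omega

/-- The finish time: the first step at whose end the source is occupied. -/
def finishTime {d k : ℕ} (ρ : ℕ → Walk d k) : ℕ :=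
  Nat.find (exists_source_mem_occupied ρ)

/-- The law of the particles' walks: independent, each uniform over the `d ^ k` paths from the
source to level `k` (that is, at every vertex the next child is chosen uniformly). -/
noncomputable def walkLaw (d k : ℕ) : Measure (ℕ → Walk d k) :=
  Measure.infinitePi fun _ => uniformOn (Set.univ : Set (Walk d k))

/-- The time scale `T = √k * d ^ (k + 3/2 - √(2k+2))`. -/
noncomputable def timeScale (d k : ℕ) : ℝ :=
  √(k : ℝ) * (d : ℝ) ^ ((k : ℝ) + 3 / 2 - √(2 * (k : ℝ) + 2))

end DLA

/-! Write $S=\sqrt{2k+2}$ and $P=d^{k+2-S}$, so that $d^{1/2}T=\sqrt k\,P$.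

Lower bound: a particle halts at level $i<k$ only if its walk meets an occupied vertex of level
$i+1$, which has probability at most (occupied vertices there)$/d^{i+1}$. Iterating, the expected
number of occupied vertices at level $k-j$ at time $t$ is at most
$\binom{t}{j+1}\prod_{i<j}d^{-(k-i)}$. If the source is occupied then every level is, so Markov's
inequality applies at any $j$. The bound is best at $j+1\approx S$; taking $\lfloor S\rfloor$ costs
a factor $d^{(\lfloor S\rfloor-S)^2/2}$ in probability, whose $\lfloor S\rfloor$-th root, the loss
in time, is at most $d^{1/\sqrt k}$ and is $1$ when $S$ is an integer (`walkLaw_finishTime_lt_le`).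

Upper bound: the process is monotone in the occupied set (`step_mono`), so occupied vertices may be
discarded. In successive phases of about $8P$ steps, $N_j$ vertices at level $k+1-j$ produce
$N_{j+1}$ at the level above, up to exponentially small error (`survival_frontier_le`). After
$r=O(\sqrt k)$ phases $d^{k-r}$ is of order $P$; waiting for one vertex at level $k-r$, and then for
a single path to climb to the source, takes expected time $O(P)$ (`survival_frontier_last_le`). The
total is $O(\sqrt k\,P)$. -/

namespace DLA

variable {d k : ℕ}

/-! ### Particle paths and monotonicity -/

/-- A halting particle has followed its walk for `l` steps through unoccupied vertices, and
either it has exhausted its walk or the next vertex is occupied. -/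
theorem exists_halt_eq (C : Finset (Vertex d)) (r : List (Fin d)) :
    ∀ u : Vertex d, ∃ l ≤ r.length, halt C u r = u ++ r.take l ∧
      (∀ i, 0 < i → i ≤ l → u ++ r.take i ∉ C) ∧ (l < r.length → u ++ r.take (l + 1) ∈ C) := by
  induction r with
  | nil => intro u; exact ⟨0, by simp, by simp [halt], by intros; omega, by simp⟩
  | cons a r ih =>
    intro u
    by_cases h : u ++ [a] ∈ C
    · exact ⟨0, by simp, by simp [halt, h], by intros; omega, by simpa using h⟩
    · obtain ⟨l, hl, he, hn, hc⟩ := ih (u ++ [a])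
      refine ⟨l + 1, by simpa using hl, by simp [halt, h, he], ?_, ?_⟩
      · intro i hi hil
        obtain ⟨i, rfl⟩ := Nat.exists_eq_succ_of_ne_zero hi.ne'
        rcases Nat.eq_zero_or_pos i with rfl | hi0
        · simpa using h
        · simpa using hn i hi0 (by omega)
      · intro hlt
        simpa using hc (by simpa using hlt)

theorem exists_halt_source_eq (C : Finset (Vertex d)) (w : Walk d k) :
    ∃ l ≤ k, halt C [] (List.ofFn w) = (List.ofFn w).take l ∧
      (∀ i, 0 < i → i ≤ l → (List.ofFn w).take i ∉ C) ∧
      (l < k → (List.ofFn w).take (l + 1) ∈ C) := by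
  simpa using exists_halt_eq C (List.ofFn w) []

/-- `C ≼ C'`: every path blocked by `C` is blocked by `C'`, at the same vertex or earlier. -/
def Dominated (C C' : Finset (Vertex d)) : Prop := ∀ u ∈ C, ∃ v ∈ C', v <+: u

theorem Dominated.of_subset {C C' : Finset (Vertex d)} (h : C ⊆ C') : Dominated C C' :=
  fun u hu => ⟨u, h hu, List.prefix_refl u⟩

theorem Dominated.trans {C C' C'' : Finset (Vertex d)} (h : Dominated C C')
    (h' : Dominated C' C'') : Dominated C C'' := fun u hu => by
  obtain ⟨v, hv, hvu⟩ := h u hu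
  obtain ⟨x, hx, hxv⟩ := h' v hv
  exact ⟨x, hx, hxv.trans hvu⟩

theorem Dominated.union {C C' C'' : Finset (Vertex d)} (h : Dominated C C'')
    (h' : Dominated C' C'') : Dominated (C ∪ C') C'' := fun u hu => by
  rcases Finset.mem_union.1 hu with hu | hu
  exacts [h u hu, h' u hu]

theorem Dominated.source_mem {C C' : Finset (Vertex d)} (h : Dominated C C') (hC : [] ∈ C) :
    [] ∈ C' := by
  obtain ⟨v, hv, hvu⟩ := h [] hC
  rwa [List.prefix_nil.1 hvu] at hv

theorem dominated_of_source_mem (C : Finset (Vertex d)) {C' : Finset (Vertex d)} (h : [] ∈ C') :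
    Dominated C C' := fun _ _ => ⟨[], h, List.nil_prefix⟩

theorem subset_step (C : Finset (Vertex d)) (w : Walk d k) : C ⊆ step C w := by
  unfold step
  split_ifs
  exacts [subset_rfl, Finset.subset_insert _ _]

/-- Both particles use the same walk. If the one in `C'` travelled farther, it would have passed the
vertex of `C'` that lies at or above the vertex of `C` blocking the first particle. -/
theorem step_mono {C C' : Finset (Vertex d)} (h : Dominated C C') (w : Walk d k) :
    Dominated (step C w) (step C' w) := by
  by_cases h' : [] ∈ C'
  · exact dominated_of_source_mem _ (subset_step _ _ h')
  have h0 : [] ∉ C := fun hC => h' (h.source_mem hC)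
  intro u hu
  rw [step, if_neg h0, Finset.mem_insert] at hu
  rcases hu with rfl | hu
  · obtain ⟨l, hl, he, -, hc⟩ := exists_halt_source_eq C w
    obtain ⟨l', hl', he', hn', -⟩ := exists_halt_source_eq C' w
    refine ⟨halt C' [] (List.ofFn w), by simp [step, h'], ?_⟩
    rw [he, he']
    suffices l' ≤ l from List.take_prefix_take_left this
    -- Here `l < l' ≤ k`, so the first particle was blocked at level `l + 1`, which the second one
    -- passed.
    by_contra! hlt
    obtain ⟨v, hv, hvu⟩ := h _ (hc (by omega))
    have hv' : v = (List.ofFn w).take v.length :=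
      List.prefix_iff_eq_take.1 (hvu.trans (List.take_prefix _ _))
    have hlen : v.length ≤ l + 1 := hvu.length_le.trans (by simp)
    refine hn' v.length ?_ (by omega) (hv' ▸ hv)
    rw [List.length_pos_iff]
    rintro rfl
    exact h' hv
  · obtain ⟨v, hv, hvu⟩ := h u hu
    exact ⟨v, subset_step _ _ hv, hvu⟩

theorem take_dominated_step {C : Finset (Vertex d)} {w : Walk d k} {i : ℕ}
    (h : i < k → (List.ofFn w).take (i + 1) ∈ C) :
    Dominated {(List.ofFn w).take i} (step C w) := by
  by_cases h0 : [] ∈ C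
  · exact dominated_of_source_mem _ (subset_step _ _ h0)
  intro u hu
  rw [Finset.mem_singleton.1 hu]
  obtain ⟨l, hl, he, hn, -⟩ := exists_halt_source_eq C w
  refine ⟨halt C [] (List.ofFn w), by simp [step, h0], ?_⟩
  rw [he]
  suffices l ≤ i from List.take_prefix_take_left this
  by_contra! hlt
  exact hn (i + 1) (by omega) (by omega) (h (by omega))

/-! ### Counting walks, one-step means and the Markov property -/

/-- The number of walks whose vertex at level `l` lies in a given set of vertices of level `l`. -/
theorem card_walk_take_mem {l : ℕ} (hl : l ≤ k) (U : Finset (Vertex d))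
    (hU : ∀ u ∈ U, u.length = l) :
    (Finset.univ.filter fun w : Walk d k => (List.ofFn w).take l ∈ U).card =
      U.card * d ^ (k - l) := by
  obtain ⟨n, rfl⟩ := Nat.exists_eq_add_of_le hl
  have h1 : (Finset.univ.filter fun x : Fin l → Fin d => List.ofFn x ∈ U).card = U.card := by
    refine Finset.card_bij (fun x _ => List.ofFn x) (fun x hx => by simpa using hx)
      (fun x _ y _ h => List.ofFn_injective h) fun u hu => ?_
    refine ⟨fun j => u.get (Fin.cast (hU u hu).symm j), ?_, ?_⟩
    · simp only [Finset.mem_filter, Finset.mem_univ, true_and]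
      have := hU u hu
      subst this
      simpa using hu
    · have := hU u hu
      subst this
      simp
  have h2 : (Finset.univ.filter fun w : Walk d (l + n) => (List.ofFn w).take l ∈ U) =
      ((Finset.univ.filter fun x : Fin l → Fin d => List.ofFn x ∈ U) ×ˢ
        (Finset.univ : Finset (Fin n → Fin d))).map (Fin.appendEquiv l n).toEmbedding := by
    ext w
    obtain ⟨⟨x, y⟩, rfl⟩ := (Fin.appendEquiv l n).surjective w
    simp only [Finset.mem_filter, Finset.mem_univ, true_and, Finset.mem_map_equiv,
      Equiv.symm_apply_apply, Finset.mem_product, and_true]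
    simp [Fin.appendEquiv, List.ofFn_fin_append]
  rw [h2, Finset.card_map, Finset.card_product, h1]
  simp

theorem occupied_congr {ρ ρ' : ℕ → Walk d k} {t : ℕ} (h : ∀ s < t, ρ s = ρ' s) :
    occupied ρ t = occupied ρ' t := by
  induction t with
  | zero => rfl
  | succ t ih =>
    rw [occupied, occupied, ih fun s hs => h s (by omega), h t (by omega)]

theorem source_mem_occupied_mono {ρ : ℕ → Walk d k} {s t : ℕ} (hst : s ≤ t)
    (h : [] ∈ occupied ρ s) : [] ∈ occupied ρ t := by
  induction t, hst using Nat.le_induction with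
  | base => exact h
  | succ t _ ih => exact subset_step _ _ ih

theorem finishTime_le_iff {ρ : ℕ → Walk d k} {t : ℕ} :
    finishTime ρ ≤ t ↔ [] ∈ occupied ρ t := by
  constructor
  · intro h
    exact source_mem_occupied_mono h (Nat.find_spec (exists_source_mem_occupied ρ))
  · intro h
    exact Nat.find_min' _ h

/-- The expected value of `f` after one step of the process from `C`. -/
noncomputable def stepMean (k : ℕ) (f : Finset (Vertex d) → ℝ) (C : Finset (Vertex d)) : ℝ :=
  (∑ w : Walk d k, f (step C w)) / (d : ℝ) ^ k

theorem stepMean_nonneg {f : Finset (Vertex d) → ℝ} (hf : ∀ C, 0 ≤ f C) (C : Finset (Vertex d)) :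
    0 ≤ stepMean k f C :=
  div_nonneg (Finset.sum_nonneg fun _ _ => hf _) (by positivity)

theorem stepMean_mono {f g : Finset (Vertex d) → ℝ} (h : ∀ C, f C ≤ g C)
    (C : Finset (Vertex d)) : stepMean k f C ≤ stepMean k g C := by
  unfold stepMean
  gcongr
  exact h _

/-- A one-step mean is at most `a - p (a - b)` if the value is always at most `a`, and at most
`b` with probability at least `p`. -/
theorem stepMean_le (hd : 0 < d) {f : Finset (Vertex d) → ℝ} {C : Finset (Vertex d)}
    {a b p : ℝ} (hba : b ≤ a) (H : Finset (Walk d k)) (hp : p * (d : ℝ) ^ k ≤ H.card)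
    (ha : ∀ w : Walk d k, f (step C w) ≤ a) (hb : ∀ w ∈ H, f (step C w) ≤ b) :
    stepMean k f C ≤ a - p * (a - b) := by
  have hd' : (0 : ℝ) < (d : ℝ) ^ k := by positivity
  have hsum : ∑ w : Walk d k, f (step C w) ≤
      ∑ w : Walk d k, (a - if w ∈ H then a - b else 0) := by
    refine Finset.sum_le_sum fun w _ => ?_
    split_ifs with hw
    · linarith [hb w hw]
    · linarith [ha w]
  have hcalc : ∑ w : Walk d k, (a - if w ∈ H then a - b else 0) =
      (d : ℝ) ^ k * a - H.card * (a - b) := by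
    simp [Finset.sum_sub_distrib, mul_sub]
  rw [stepMean, div_le_iff₀ hd']
  nlinarith [mul_le_mul_of_nonneg_right hp (sub_nonneg.2 hba)]

theorem lintegral_walk (hd : 0 < d) {f : Finset (Vertex d) → ℝ} (hf : ∀ C, 0 ≤ f C)
    (C : Finset (Vertex d)) :
    ∫⁻ w : Walk d k, ENNReal.ofReal (f (step C w)) ∂(uniformOn Set.univ) =
      ENNReal.ofReal (stepMean k f C) := by
  have hd' : (0 : ℝ) < (d : ℝ) ^ k := by positivity
  rw [lintegral_fintype, stepMean, ENNReal.ofReal_div_of_pos hd',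
    ENNReal.ofReal_sum_of_nonneg fun _ _ => hf _, ENNReal.div_eq_inv_mul, Finset.mul_sum]
  refine Finset.sum_congr rfl fun w _ => ?_
  rw [uniformOn_univ, mul_comm, Measure.count_singleton]
  congr 1
  rw [one_div, ENNReal.ofReal_pow (by positivity)]
  simp

theorem measurable_comp_occupied {α : Type*} [MeasurableSpace α] (f : Finset (Vertex d) → α)
    (t : ℕ) : Measurable fun ρ : ℕ → Walk d k => f (occupied ρ t) := by
  let _ : MeasurableSpace (Finset (Vertex d)) := ⊤
  suffices h : Measurable fun ρ : ℕ → Walk d k => occupied ρ t from measurable_from_top.comp h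
  induction t with
  | zero => exact measurable_const
  | succ t ih =>
    have hs : Measurable fun p : Finset (Vertex d) × Walk d k => step p.1 p.2 :=
      measurable_of_countable _
    exact hs.comp (ih.prodMk (measurable_pi_apply t))

/-- The Markov property of the process of occupied sets. -/
theorem lintegral_occupied_succ (hd : 0 < d) {f : Finset (Vertex d) → ℝ} (hf : ∀ C, 0 ≤ f C)
    (t : ℕ) :
    ∫⁻ ρ, ENNReal.ofReal (f (occupied ρ (t + 1))) ∂walkLaw d k =
      ∫⁻ ρ, ENNReal.ofReal (stepMean k f (occupied ρ t)) ∂walkLaw d k := by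
  have : Nonempty (Fin d) := ⟨⟨0, hd⟩⟩
  let _ : MeasurableSpace (Finset (Vertex d)) := ⊤
  have hprob : ∀ _ : ℕ, IsProbabilityMeasure (uniformOn (Set.univ : Set (Walk d k))) :=
    fun _ => inferInstance
  have hind : iIndepFun (fun (s : ℕ) (ρ : ℕ → Walk d k) => ρ s) (walkLaw d k) :=
    iIndepFun_infinitePi (P := fun _ : ℕ => uniformOn (Set.univ : Set (Walk d k)))
      (X := fun _ x => x) fun _ => measurable_id
  have hfin := hind.indepFun_finset (Finset.range t) {t} (by simp) fun s => measurable_pi_apply s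
  -- The set occupied at time `t` depends only on the first `t` walks, so the others are filled in
  -- arbitrarily; this gives its independence from walk `t`.
  let g : (Finset.range t → Walk d k) → Finset (Vertex d) := fun x =>
    occupied (fun s => if h : s ∈ Finset.range t then x ⟨s, h⟩ else fun _ => Classical.arbitrary _) t
  let h : (({t} : Finset ℕ) → Walk d k) → Walk d k := fun x => x ⟨t, by simp⟩
  have hg : Measurable g := measurable_of_countable g
  have hh : Measurable h := measurable_pi_apply _
  have hocc : ∀ ρ : ℕ → Walk d k, g (fun s => ρ s) = occupied ρ t := fun ρ =>
    occupied_congr fun s hs => by simp [hs]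
  have hXY : IndepFun (fun ρ : ℕ → Walk d k => occupied ρ t) (fun ρ => ρ t) (walkLaw d k) := by
    have := hfin.comp hg hh
    refine this.congr ?_ ?_
    · exact .of_forall fun ρ => hocc ρ
    · exact .of_forall fun ρ => rfl
  have hX : Measurable fun ρ : ℕ → Walk d k => occupied ρ t := measurable_comp_occupied id t
  have hY : Measurable fun ρ : ℕ → Walk d k => ρ t := measurable_pi_apply t
  have : IsProbabilityMeasure (walkLaw d k) := by unfold walkLaw; infer_instance
  have hmap := (indepFun_iff_map_prod_eq_prod_map_map hX.aemeasurable hY.aemeasurable).1 hXY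
  have hYlaw : (walkLaw d k).map (fun ρ => ρ t) = uniformOn Set.univ :=
    Measure.infinitePi_map_eval (fun _ : ℕ => uniformOn (Set.univ : Set (Walk d k))) t
  have hF : Measurable fun p : Finset (Vertex d) × Walk d k =>
      ENNReal.ofReal (f (step p.1 p.2)) := measurable_of_countable _
  calc ∫⁻ ρ, ENNReal.ofReal (f (occupied ρ (t + 1))) ∂walkLaw d k
      = ∫⁻ p, ENNReal.ofReal (f (step p.1 p.2))
          ∂((walkLaw d k).map fun ρ => (occupied ρ t, ρ t)) := by
        rw [lintegral_map hF (hX.prodMk hY)]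
        rfl
    _ = ∫⁻ C, ENNReal.ofReal (stepMean k f C) ∂((walkLaw d k).map fun ρ => occupied ρ t) := by
        rw [hmap, hYlaw, lintegral_prod _ hF.aemeasurable]
        simp_rw [lintegral_walk hd hf]
    _ = _ := lintegral_map (measurable_of_countable _) hX

theorem lintegral_occupied (hd : 0 < d) (t : ℕ) : ∀ {f : Finset (Vertex d) → ℝ},
    (∀ C, 0 ≤ f C) →
    ∫⁻ ρ, ENNReal.ofReal (f (occupied ρ t)) ∂walkLaw d k =
      ENNReal.ofReal ((stepMean k)^[t] f ∅) := by
  have : Nonempty (Fin d) := ⟨⟨0, hd⟩⟩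
  have : IsProbabilityMeasure (walkLaw d k) := by unfold walkLaw; infer_instance
  induction t with
  | zero => intro f hf; simp [occupied]
  | succ t ih =>
    intro f hf
    rw [lintegral_occupied_succ hd hf, ih (stepMean_nonneg hf), Function.iterate_succ_apply]

/-- Markov's inequality for an event determined by the set occupied at time `t`. -/
theorem walkLaw_occupied_le (hd : 0 < d) (t : ℕ) {f : Finset (Vertex d) → ℝ}
    (hf : ∀ C, 0 ≤ f C) {E : Set (ℕ → Walk d k)} (hE : ∀ ρ ∈ E, 1 ≤ f (occupied ρ t)) :
    walkLaw d k E ≤ ENNReal.ofReal ((stepMean k)^[t] f ∅) := by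
  rw [← lintegral_occupied hd t hf]
  calc walkLaw d k E ≤ walkLaw d k {ρ | 1 ≤ ENNReal.ofReal (f (occupied ρ t))} := by
        refine measure_mono fun ρ hρ => ?_
        simpa using hE ρ hρ
    _ ≤ _ := by
        exact le_of_eq_of_le (one_mul _).symm (mul_meas_ge_le_lintegral
          (measurable_comp_occupied (fun C => ENNReal.ofReal (f C)) t) 1)

theorem iterate_stepMean_mono {f g : Finset (Vertex d) → ℝ} (h : ∀ C, f C ≤ g C) (t : ℕ) :
    ∀ C : Finset (Vertex d), (stepMean k)^[t] f C ≤ (stepMean k)^[t] g C := by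
  induction t with
  | zero => exact h
  | succ t ih =>
    intro C
    rw [Function.iterate_succ_apply', Function.iterate_succ_apply']
    exact stepMean_mono ih C

theorem iterate_stepMean_add_mul (f g : Finset (Vertex d) → ℝ) (c : ℝ) (t : ℕ) :
    (stepMean k)^[t] (fun C => f C + c * g C) =
      fun C => (stepMean k)^[t] f C + c * (stepMean k)^[t] g C := by
  induction t with
  | zero => rfl
  | succ t ih =>
    ext C
    simp only [Function.iterate_succ_apply', ih]
    simp only [stepMean, Finset.sum_add_distrib, ← Finset.mul_sum]
    ring

theorem iterate_stepMean_const (hd : 0 < d) (c : ℝ) (t : ℕ) :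
    (stepMean k)^[t] (fun _ : Finset (Vertex d) => c) = fun _ => c := by
  have hd' : (0 : ℝ) < (d : ℝ) ^ k := by positivity
  induction t with
  | zero => rfl
  | succ t ih =>
    ext C
    rw [Function.iterate_succ_apply', ih]
    simp [stepMean, hd'.ne']

/-! ### First moments of the level counts -/

/-- The number of occupied vertices at level `i`. -/
def levelCount (i : ℕ) (C : Finset (Vertex d)) : ℕ := (C.filter fun u => u.length = i).card

theorem levelCount_step_le (C : Finset (Vertex d)) (w : Walk d k) (i : ℕ) :
    levelCount i (step C w) ≤
      levelCount i C + if i < k → (List.ofFn w).take (i + 1) ∈ C then 1 else 0 := by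
  unfold step
  split_ifs with h0 h h
  · omega
  · omega
  · unfold levelCount
    rw [Finset.filter_insert]
    split_ifs
    · exact Finset.card_insert_le _ _
    · omega
  · obtain ⟨l, hl, he, -, hc⟩ := exists_halt_source_eq C w
    have hne : (halt C [] (List.ofFn w)).length ≠ i := by
      rintro rfl
      refine h fun hlt => ?_
      have : (halt C [] (List.ofFn w)).length = l := by rw [he]; simpa using hl
      rw [this] at hlt ⊢
      exact hc hlt
    simp [levelCount, Finset.filter_insert, hne]

theorem stepMean_levelCount_last_le (hd : 0 < d) (C : Finset (Vertex d)) :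
    stepMean k (fun C => (levelCount k C : ℝ)) C ≤ levelCount k C + 1 := by
  have hd' : (0 : ℝ) < (d : ℝ) ^ k := by positivity
  have h := fun w : Walk d k => levelCount_step_le C w k
  simp only [lt_irrefl, false_imp_iff, if_true] at h
  rw [stepMean, div_le_iff₀ hd']
  calc ∑ w : Walk d k, (levelCount k (step C w) : ℝ)
      ≤ ∑ _w : Walk d k, ((levelCount k C : ℝ) + 1) :=
        Finset.sum_le_sum fun w _ => by exact_mod_cast h w
    _ = _ := by simp; ring

/-- A uniform walk passes through a given vertex of level `i + 1` with probability $d^{-(i+1)}$, and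
without such a collision level `i` gains nothing. -/
theorem stepMean_levelCount_le (hd : 0 < d) {i : ℕ} (hi : i < k) (C : Finset (Vertex d)) :
    stepMean k (fun C => (levelCount i C : ℝ)) C ≤
      levelCount i C + ((d : ℝ) ^ (i + 1))⁻¹ * levelCount (i + 1) C := by
  have hd' : (0 : ℝ) < (d : ℝ) ^ k := by positivity
  have hd1 : (0 : ℝ) < d := by positivity
  have hcard := card_walk_take_mem (k := k) (l := i + 1) hi (C.filter fun u => u.length = i + 1)
    (by simp)
  rw [stepMean, div_le_iff₀ hd']
  calc ∑ w : Walk d k, (levelCount i (step C w) : ℝ)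
      ≤ ∑ w : Walk d k, ((levelCount i C : ℝ) +
          if (List.ofFn w).take (i + 1) ∈ C.filter (fun u => u.length = i + 1) then 1 else 0) := by
        refine Finset.sum_le_sum fun w _ => ?_
        have h := levelCount_step_le C w i
        have hlen : ((List.ofFn w).take (i + 1)).length = i + 1 := by simpa using hi
        simp only [hi, true_imp_iff] at h
        simp only [Finset.mem_filter, hlen, and_true]
        exact_mod_cast h
    _ = (d : ℝ) ^ k * levelCount i C + levelCount (i + 1) C * (d : ℝ) ^ (k - (i + 1)) := by
        rw [Finset.sum_add_distrib, Finset.sum_boole, hcard]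
        simp [levelCount]
    _ = _ := by
        rw [show (d : ℝ) ^ k = (d : ℝ) ^ (i + 1) * (d : ℝ) ^ (k - (i + 1)) by
          rw [← pow_add]; congr 1; omega]
        field_simp

/-- The first moment bound: the expected number of occupied vertices `j` levels above the last
one is at most the expected number of increasing chains of `j + 1` colliding particles. -/
theorem iterate_stepMean_levelCount_le (hd : 0 < d) (t : ℕ) : ∀ j ≤ k,
    (stepMean k)^[t] (fun C : Finset (Vertex d) => (levelCount (k - j) C : ℝ)) ∅ ≤
      t.choose (j + 1) / ∏ i ∈ Finset.range j, (d : ℝ) ^ (k - i) := by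
  have hd1 : (0 : ℝ) < d := by positivity
  induction t with
  | zero => intro j _; simp [levelCount]
  | succ t ih =>
    intro j hj
    rw [Function.iterate_succ_apply]
    cases j with
    | zero =>
      refine (iterate_stepMean_mono (stepMean_levelCount_last_le hd) t ∅).trans ?_
      have h := iterate_stepMean_add_mul (k := k)
        (fun C : Finset (Vertex d) => (levelCount k C : ℝ)) (fun _ => 1) 1 t
      simp only [mul_one, iterate_stepMean_const hd] at h
      rw [h]
      have := ih 0 (by omega)
      simp only [Nat.sub_zero, zero_add, Nat.choose_one_right, Finset.range_zero,
        Finset.prod_empty, div_one] at this ⊢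
      push_cast
      linarith
    | succ j =>
      refine (iterate_stepMean_mono (stepMean_levelCount_le hd (by omega)) t ∅).trans ?_
      rw [iterate_stepMean_add_mul]
      have h1 := ih (j + 1) hj
      have h2 := ih j (by omega)
      rw [show k - (j + 1) + 1 = k - j by omega]
      refine (add_le_add h1 (mul_le_mul_of_nonneg_left h2 (by positivity))).trans_eq ?_
      -- The recursion in `t` and `j` is Pascal's rule.
      rw [Nat.choose_succ_succ' t (j + 1), Finset.prod_range_succ]
      have hp : (0 : ℝ) < ∏ i ∈ Finset.range j, (d : ℝ) ^ (k - i) :=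
        Finset.prod_pos fun _ _ => by positivity
      push_cast
      field_simp
      ring

/-- A particle halts above the last level only because its next vertex is occupied, and occupied
vertices stay occupied. -/
theorem exists_child_mem_occupied (ρ : ℕ → Walk d k) (t : ℕ) :
    ∀ u ∈ occupied ρ t, u.length < k → ∃ v ∈ occupied ρ t, v.length = u.length + 1 := by
  induction t with
  | zero => simp [occupied]
  | succ t ih =>
    intro u hu huk
    by_cases h0 : [] ∈ occupied ρ t
    · rw [occupied, step, if_pos h0] at hu ⊢
      exact ih u hu huk
    have hsub := subset_step (occupied ρ t) (ρ t)
    have hu' := hu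
    rw [occupied, step, if_neg h0, Finset.mem_insert] at hu'
    rcases hu' with rfl | hu'
    · obtain ⟨l, hl, he, -, hc⟩ := exists_halt_source_eq (occupied ρ t) (ρ t)
      have hlen : (halt (occupied ρ t) [] (List.ofFn (ρ t))).length = l := by
        rw [he]; simpa using hl
      rw [hlen] at huk ⊢
      exact ⟨_, hsub (hc huk), by simpa using huk⟩
    · obtain ⟨v, hv, hvu⟩ := ih u hu' huk
      exact ⟨v, hsub hv, hvu⟩

theorem levelCount_occupied_pos {ρ : ℕ → Walk d k} {t : ℕ} (h : [] ∈ occupied ρ t) :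
    ∀ i ≤ k, 0 < levelCount i (occupied ρ t) := by
  intro i
  induction i with
  | zero => intro _; exact Finset.card_pos.2 ⟨[], by simpa using h⟩
  | succ i ih =>
    intro hi
    obtain ⟨u, hu⟩ := Finset.card_pos.1 (ih (by omega))
    rw [Finset.mem_filter] at hu
    obtain ⟨v, hv, hvl⟩ := exists_child_mem_occupied ρ t u hu.1 (by omega)
    exact Finset.card_pos.2 ⟨v, by simp [hv, hvl, hu.2]⟩

theorem walkLaw_finishTime_le_le (hd : 0 < d) (t : ℕ) {j : ℕ} (hj : j ≤ k) :
    walkLaw d k {ρ | finishTime ρ ≤ t} ≤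
      ENNReal.ofReal (t.choose (j + 1) / ∏ i ∈ Finset.range j, (d : ℝ) ^ (k - i)) := by
  refine (walkLaw_occupied_le hd t (f := fun C => (levelCount (k - j) C : ℝ))
    (fun _ => Nat.cast_nonneg _) fun ρ hρ => ?_).trans
    (ENNReal.ofReal_le_ofReal (iterate_stepMean_levelCount_le hd t j hj))
  exact_mod_cast levelCount_occupied_pos (finishTime_le_iff.1 hρ) (k - j) (by omega)

/-! ### The lower tail of the finish time -/

theorem prod_pow_sub_eq (hd : 0 < d) : ∀ j ≤ k + 1, ∏ i ∈ Finset.range j, (d : ℝ) ^ (k - i) =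
    (d : ℝ) ^ ((j : ℝ) * k - j * (j - 1) / 2) := by
  have hd1 : (0 : ℝ) < d := by positivity
  intro j
  induction j with
  | zero => simp
  | succ j ih =>
    intro hj
    rw [Finset.prod_range_succ, ih (by omega), ← Real.rpow_natCast, ← Real.rpow_add hd1]
    congr 1
    rw [Nat.cast_sub (by omega)]
    push_cast
    ring

theorem sq_sqrt_two_mul_add_two (k : ℕ) : √(2 * (k : ℝ) + 2) ^ 2 = 2 * k + 2 :=
  Real.sq_sqrt (by positivity)

theorem two_le_sqrt (hk : 1 ≤ k) : 2 ≤ √(2 * (k : ℝ) + 2) := by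
  apply Real.le_sqrt_of_sq_le
  have : (1 : ℝ) ≤ k := by exact_mod_cast hk
  linarith

theorem sqrt_le_add_one (hk : 1 ≤ k) : √(2 * (k : ℝ) + 2) ≤ k + 1 := by
  have : (1 : ℝ) ≤ k := by exact_mod_cast hk
  rw [Real.sqrt_le_left (by positivity)]
  nlinarith

theorem sqrt_le_sqrt_two_mul_add_two (k : ℕ) : √(k : ℝ) ≤ √(2 * (k : ℝ) + 2) :=
  Real.sqrt_le_sqrt (by have : (0 : ℝ) ≤ k := by positivity
                        linarith)

theorem sqrt_le_two_mul_floor (hk : 1 ≤ k) :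
    √(k : ℝ) ≤ 2 * (⌊√(2 * (k : ℝ) + 2)⌋₊ : ℝ) := by
  have h1 := Nat.lt_floor_add_one √(2 * (k : ℝ) + 2)
  have h2 := two_le_sqrt hk
  have h3 := sqrt_le_sqrt_two_mul_add_two k
  linarith

/-- The finish time is unlikely to be much smaller than the time scale. -/
theorem walkLaw_finishTime_lt_le (hd : 2 ≤ d) (hk : 1 ≤ k) {y : ℝ} (hy : 0 < y) :
    walkLaw d k {ρ | (finishTime ρ : ℝ) < timeScale d k / y} ≤
      ENNReal.ofReal ((6 / y) ^ ⌊√(2 * (k : ℝ) + 2)⌋₊ *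
        (d : ℝ) ^ ((⌊√(2 * (k : ℝ) + 2)⌋₊ - √(2 * (k : ℝ) + 2)) ^ 2 / 2)) := by
  set S := √(2 * (k : ℝ) + 2) with hS
  set s := ⌊S⌋₊ with hs
  have hd1 : (0 : ℝ) < d := by positivity
  have hs2 : 2 ≤ s := Nat.le_floor (two_le_sqrt hk)
  have hsk : s ≤ k + 1 := by
    have : (s : ℝ) ≤ k + 1 := (Nat.floor_le (by positivity)).trans (sqrt_le_add_one hk)
    exact_mod_cast this
  obtain ⟨j, hj⟩ : ∃ j, s = j + 1 := ⟨s - 1, by omega⟩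
  set x := timeScale d k / y with hx
  -- The largest integer strictly below `x`.
  set t := ⌈x⌉₊ - 1 with ht
  have hk0 : (0 : ℝ) < k := by exact_mod_cast hk
  have hx0 : 0 < x := by unfold x timeScale; positivity
  have hceil : 0 < ⌈x⌉₊ := Nat.ceil_pos.2 hx0
  have htx : (t : ℝ) ≤ x := (Nat.lt_ceil.1 (by omega : t < ⌈x⌉₊)).le
  have hsub : {ρ : ℕ → Walk d k | (finishTime ρ : ℝ) < x} ⊆ {ρ | finishTime ρ ≤ t} := by
    intro ρ hρ
    have hlt : (finishTime ρ : ℝ) < x := hρ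
    have := Nat.lt_ceil.2 hlt
    show finishTime ρ ≤ t
    omega
  refine (measure_mono hsub).trans ((walkLaw_finishTime_le_le (by omega) t
    (show j ≤ k by omega)).trans (ENNReal.ofReal_le_ofReal ?_))
  rw [prod_pow_sub_eq (by omega) j (by omega), ← hj]
  have hs0 : (0 : ℝ) < s := by positivity
  have hfact : ((s : ℝ) / Real.exp 1) ^ s ≤ s.factorial := by
    have h := Real.pow_div_factorial_le_exp (s : ℝ) hs0.le s
    rw [div_le_iff₀ (by positivity)] at h
    rw [div_pow, ← Real.exp_nat_mul, mul_one, div_le_iff₀ (Real.exp_pos _)]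
    linarith
  -- The constant $6$ comes from $e\le 3$ and $\sqrt k\le 2s$.
  have hbase : x / (s / Real.exp 1) ≤ 6 / y * (d : ℝ) ^ ((k : ℝ) + 3 / 2 - S) := by
    have he : Real.exp 1 ≤ 3 := Real.exp_one_lt_three.le
    have h1 : √(k : ℝ) * Real.exp 1 ≤ 6 * s := by
      have := sqrt_le_two_mul_floor hk
      calc √(k : ℝ) * Real.exp 1 ≤ (2 * s) * 3 := by gcongr
        _ = 6 * s := by ring
    have h2 : x / (s / Real.exp 1) =
        (√(k : ℝ) * Real.exp 1 / s) / y * (d : ℝ) ^ ((k : ℝ) + 3 / 2 - S) := by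
      rw [hx, timeScale, ← hS]
      field_simp
    rw [h2]
    gcongr
    rwa [div_le_iff₀ hs0]
  have hj' : (j : ℝ) = s - 1 := by rw [hj]; push_cast; ring
  calc (t.choose s : ℝ) / (d : ℝ) ^ ((j : ℝ) * k - j * (j - 1) / 2)
      ≤ ((t : ℝ) ^ s / s.factorial) / (d : ℝ) ^ ((j : ℝ) * k - j * (j - 1) / 2) := by
        gcongr
        exact Nat.choose_le_pow_div s t
    _ ≤ (x ^ s / (s / Real.exp 1) ^ s) / (d : ℝ) ^ ((j : ℝ) * k - j * (j - 1) / 2) := by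
        gcongr
    _ = (x / (s / Real.exp 1)) ^ s / (d : ℝ) ^ ((j : ℝ) * k - j * (j - 1) / 2) := by
        rw [div_pow x]
    _ ≤ (6 / y * (d : ℝ) ^ ((k : ℝ) + 3 / 2 - S)) ^ s /
          (d : ℝ) ^ ((j : ℝ) * k - j * (j - 1) / 2) := by
        gcongr
    -- Completing the square: with $S^2=2k+2$ and $j=s-1$, $s(k+3/2-S)-jk+j(j-1)/2=(s-S)^2/2$.
    _ = (6 / y) ^ s * (d : ℝ) ^ ((s - S) ^ 2 / 2) := by
        rw [mul_pow, ← Real.rpow_mul_natCast hd1.le, mul_div_assoc, ← Real.rpow_sub hd1]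
        congr 2
        have := sq_sqrt_two_mul_add_two k
        rw [← hS] at this
        rw [hj']
        linear_combination (-1 / 2 : ℝ) * this

/-! ### Survival probabilities and growth at one level -/

/-- The probability that, starting from the occupied set `C`, the source is still unoccupied
after `t` steps. -/
noncomputable def survival (k t : ℕ) : Finset (Vertex d) → ℝ :=
  (stepMean k)^[t] fun C => if [] ∈ C then 0 else 1

theorem survival_zero (C : Finset (Vertex d)) :
    survival k 0 C = if [] ∈ C then 0 else 1 := rfl

theorem survival_succ (t : ℕ) (C : Finset (Vertex d)) :
    survival k (t + 1) C = stepMean k (survival k t) C := by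
  rw [survival, Function.iterate_succ_apply']
  rfl

theorem survival_le_one (hd : 0 < d) (t : ℕ) (C : Finset (Vertex d)) : survival k t C ≤ 1 := by
  have h := iterate_stepMean_mono (k := k) (g := fun _ : Finset (Vertex d) => (1 : ℝ))
    (f := fun C => if [] ∈ C then 0 else 1) (fun C => by split_ifs <;> norm_num) t C
  rwa [iterate_stepMean_const hd] at h

theorem survival_anti {C C' : Finset (Vertex d)} (h : Dominated C C') (t : ℕ) :
    survival k t C' ≤ survival k t C := by
  induction t generalizing C C' with
  | zero =>
    have := h.source_mem
    simp only [survival_zero]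
    split_ifs with h1 h2 <;> simp_all
  | succ t ih =>
    simp only [survival_succ, stepMean]
    gcongr with w
    exact ih (step_mono h w)

theorem survival_succ_le (hd : 0 < d) (t : ℕ) (C : Finset (Vertex d)) :
    survival k (t + 1) C ≤ survival k t C := by
  rw [survival_succ]
  have h := stepMean_le (k := k) hd (f := survival k t) (C := C) (a := survival k t C)
    (b := survival k t C) (p := 0) le_rfl ∅ (by simp)
    (fun w => survival_anti (.of_subset (subset_step C w)) t) (by simp)
  linarith

theorem survival_antitone (hd : 0 < d) (C : Finset (Vertex d)) :
    Antitone fun t => survival k t C :=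
  antitone_nat_of_succ_le fun t => survival_succ_le hd t C

theorem le_one_of_mul_le_card (hd : 0 < d) {q : ℝ} {H : Finset (Walk d k)}
    (hq : q * (d : ℝ) ^ k ≤ H.card) : q ≤ 1 := by
  have hd' : (0 : ℝ) < (d : ℝ) ^ k := by positivity
  have h : (H.card : ℝ) ≤ (d : ℝ) ^ k := by
    have := Finset.card_le_univ H
    simp only [Fintype.card_pi, Fintype.card_fin, Finset.prod_const, Finset.card_univ] at this
    exact_mod_cast this
  have : q * (d : ℝ) ^ k ≤ 1 * (d : ℝ) ^ k := by linarith
  exact le_of_mul_le_mul_right this hd'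

/-- If the occupied set `U` stops a particle at level `i` with probability at least `q`, then
after `m` steps there are at least `N` occupied vertices at level `i`, up to a small error. -/
theorem survival_union_le (hd : 0 < d) {U : Finset (Vertex d)} {i t : ℕ} (hi : i ≤ k) {q N M : ℝ}
    (H : Finset (Walk d k))
    (hH : ∀ w ∈ H, Dominated {(List.ofFn w).take i} (step U w))
    (hq : q * (d : ℝ) ^ k ≤ H.card) (hN : N ≤ q * (d : ℝ) ^ i / 2) (hM0 : 0 ≤ M)
    (hM : ∀ D : Finset (Vertex d), (∀ u ∈ D, u.length = i) → N ≤ D.card → survival k t D ≤ M)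
    (m : ℕ) : ∀ D : Finset (Vertex d), (∀ u ∈ D, u.length = i) →
      survival k (t + m) (U ∪ D) ≤ M + Real.exp (N - D.card) * (1 - q / 4) ^ m := by
  have hq1 : q ≤ 1 := le_one_of_mul_le_card hd hq
  have hβ : 0 ≤ 1 - q / 4 := by linarith
  have hd' : (0 : ℝ) < d := by positivity
  induction m with
  | zero =>
    intro D hD
    by_cases hDN : N ≤ D.card
    · have h1 := survival_anti (k := k) (.of_subset (Finset.subset_union_right (s₁ := U))) t
        |>.trans (hM D hD hDN)
      have := Real.exp_pos (N - D.card)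
      simp only [Nat.add_zero, pow_zero, mul_one]
      linarith
    · have h1 : 1 ≤ Real.exp (N - D.card) := Real.one_le_exp (by linarith)
      have := survival_le_one (k := k) hd (t + 0) (U ∪ D)
      simp only [pow_zero, mul_one]
      linarith
  | succ m ih =>
    intro D hD
    by_cases hDN : N ≤ D.card
    · have h1 := survival_anti (k := k) (.of_subset (Finset.subset_union_right (s₁ := U))) t
        |>.trans (hM D hD hDN)
      have h2 := survival_antitone (k := k) hd (U ∪ D) (show t ≤ t + (m + 1) by omega)
      have h3 : 0 ≤ Real.exp (N - D.card) * (1 - q / 4) ^ (m + 1) := by positivity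
      simp only at h2
      linarith
    · rw [← add_assoc, survival_succ]
      have hsub : ∀ w : Walk d k, Dominated (U ∪ D) (step (U ∪ D) w) := fun w =>
        .of_subset (subset_step _ w)
      -- Since $|D|<N\le q d^i/2$, the vertices already in `D` account for at most half of the good
      -- walks. Each remaining one adds a vertex and at least halves the potential $e^{N-|D|}$,
      -- whence the factor $1-q/4$ per step.
      have hcard : q / 2 * (d : ℝ) ^ k ≤
          (H.filter fun w => (List.ofFn w).take i ∉ D).card := by
        have h1 := Finset.card_filter_add_card_filter_not (s := H)
          fun w => (List.ofFn w).take i ∈ D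
        have h2 := (Finset.card_le_card (Finset.filter_subset_filter
          (fun w => (List.ofFn w).take i ∈ D) H.subset_univ)).trans_eq
          (card_walk_take_mem hi D hD)
        have h3 : (H.card : ℝ) ≤ D.card * (d : ℝ) ^ (k - i) +
            (H.filter fun w => (List.ofFn w).take i ∉ D).card := by
          rw [← h1]
          exact_mod_cast Nat.add_le_add h2 (Finset.card_le_card (by intro w; simp))
        have h4 : (d : ℝ) ^ k = (d : ℝ) ^ i * (d : ℝ) ^ (k - i) := by
          rw [← pow_add]; congr 1; omega
        have h5 : (D.card : ℝ) * (d : ℝ) ^ (k - i) ≤ q * (d : ℝ) ^ i / 2 * (d : ℝ) ^ (k - i) := by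
          gcongr
          linarith
        have h6 : q * (d : ℝ) ^ i / 2 * (d : ℝ) ^ (k - i) = q / 2 * (d : ℝ) ^ k := by
          rw [h4]; ring
        linarith
      have hexp : Real.exp (N - D.card - 1) ≤ Real.exp (N - D.card) / 2 := by
        rw [Real.exp_sub]
        gcongr
        linarith [Real.add_one_le_exp 1]
      set E := Real.exp (N - D.card) with hE
      have hEpos : 0 < E := Real.exp_pos _
      have hmean := stepMean_le (k := k) hd (f := survival k (t + m)) (C := U ∪ D)
        (a := M + E * (1 - q / 4) ^ m) (b := M + E / 2 * (1 - q / 4) ^ m) (p := q / 2)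
        (by gcongr; linarith) _ hcard
        (fun w => (survival_anti (hsub w) _).trans (ih D hD)) ?_
      · refine hmean.trans_eq ?_
        rw [pow_succ]
        ring
      · intro w hw
        rw [Finset.mem_filter] at hw
        -- `U` is kept intact, so the success probability does not decay as `D` grows.
        have hdom : Dominated (U ∪ insert ((List.ofFn w).take i) D) (step (U ∪ D) w) := by
          rw [Finset.insert_eq, ← Finset.union_assoc, Finset.union_right_comm]
          exact (hsub w).union ((hH w hw.1).trans
            (step_mono (.of_subset Finset.subset_union_left) w))
        refine (survival_anti hdom _).trans ((ih _ ?_).trans ?_)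
        · intro u hu
          rcases Finset.mem_insert.1 hu with rfl | hu
          · simpa using hi
          · exact hD u hu
        · rw [Finset.card_insert_of_notMem hw.2]
          push_cast
          rw [← sub_sub]
          gcongr

/-- Starting from $D=\emptyset$ the error is $e^N(1-q/4)^m\le e^{N-mq/4}$, and `hNm` turns this into
$e^{-N}$. -/
theorem survival_add_le (hd : 0 < d) {U : Finset (Vertex d)} {i t m : ℕ} (hi : i ≤ k)
    {q N M : ℝ} (H : Finset (Walk d k))
    (hH : ∀ w ∈ H, Dominated {(List.ofFn w).take i} (step U w))
    (hq : q * (d : ℝ) ^ k ≤ H.card) (hN : N ≤ q * (d : ℝ) ^ i / 2) (hNm : N ≤ m * q / 8)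
    (hM0 : 0 ≤ M)
    (hM : ∀ D : Finset (Vertex d), (∀ u ∈ D, u.length = i) → N ≤ D.card → survival k t D ≤ M) :
    survival k (t + m) U ≤ M + Real.exp (-N) := by
  have h := survival_union_le hd hi H hH hq hN hM0 hM m ∅ (by simp)
  have hq1 : q ≤ 1 := le_one_of_mul_le_card hd hq
  have hpow : (1 - q / 4) ^ m ≤ Real.exp (-(m * q / 4)) := by
    calc (1 - q / 4) ^ m ≤ Real.exp (-(q / 4)) ^ m :=
          pow_le_pow_left₀ (by linarith) (Real.one_sub_le_exp_neg _) m
      _ = _ := by rw [← Real.exp_nat_mul]; congr 1; ring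
  have hexp : Real.exp N * (1 - q / 4) ^ m ≤ Real.exp (-N) := by
    calc Real.exp N * (1 - q / 4) ^ m ≤ Real.exp N * Real.exp (-(m * q / 4)) := by gcongr
      _ = Real.exp (N - m * q / 4) := by rw [← Real.exp_add]; congr 1
      _ ≤ _ := Real.exp_le_exp.2 (by linarith)
  simp only [Finset.union_empty, Finset.card_empty, Nat.cast_zero, sub_zero] at h
  linarith

/-- A bound on the expected remaining time, truncated at `t`, in terms of the waiting time for
level `i` to be reached. -/
theorem sum_survival_le (hd : 0 < d) {U : Finset (Vertex d)} {i : ℕ} (hi : i ≤ k) {q B : ℝ}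
    (hq0 : 0 < q) (H : Finset (Walk d k))
    (hH : ∀ w ∈ H, Dominated {(List.ofFn w).take i} (step U w))
    (hq : q * (d : ℝ) ^ k ≤ H.card) (hB0 : 0 ≤ B)
    (hB : ∀ v : Vertex d, v.length = i → ∀ t, ∑ s ∈ Finset.range t, survival k s {v} ≤ B)
    (t : ℕ) : ∑ s ∈ Finset.range t, survival k s U ≤ 1 / q + B := by
  induction t with
  | zero => simp; positivity
  | succ t ih =>
    rw [Finset.sum_range_succ']
    have h0 := survival_le_one (k := k) hd 0 U
    have hsum : ∑ s ∈ Finset.range t, survival k (s + 1) U =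
        stepMean k (fun C => ∑ s ∈ Finset.range t, survival k s C) U := by
      simp only [survival_succ, stepMean]
      rw [Finset.sum_comm, Finset.sum_div]
    have hmean := stepMean_le (k := k) hd
      (f := fun C => ∑ s ∈ Finset.range t, survival k s C) (C := U) (a := 1 / q + B) (b := B)
      (p := q) (by have : 0 < 1 / q := by positivity
                   linarith) H hq
      (fun w => (Finset.sum_le_sum fun s _ =>
        survival_anti (.of_subset (subset_step U w)) s).trans ih)
      (fun w hw => (Finset.sum_le_sum fun s _ => survival_anti (hH w hw) s).trans
        (hB _ (by simpa using hi) t))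
    -- The drop of $1$ pays for the term `s = 0`.
    have hcalc : 1 / q + B - q * (1 / q + B - B) = 1 / q + B - 1 := by field_simp; ring
    rw [hsum]
    linarith

/-- A given vertex of level `i + 1` is hit after expected time $d^{i+1}$, so the climb costs at most
$d^{i+1}+2d^i\le 2d^{i+1}$, as $d\ge2$. -/
theorem sum_survival_singleton_le (hd : 2 ≤ d) (i : ℕ) : i ≤ k → ∀ v : Vertex d, v.length = i →
    ∀ t, ∑ s ∈ Finset.range t, survival k s {v} ≤ 2 * (d : ℝ) ^ i := by
  have hd2 : (2 : ℝ) ≤ d := by exact_mod_cast hd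
  induction i with
  | zero =>
    intro _ v hv t
    rw [List.length_eq_zero_iff.1 hv]
    refine (Finset.sum_nonpos fun s _ => ?_).trans (by norm_num)
    refine (survival_antitone (k := k) (by omega) {[]} (Nat.zero_le s)).trans ?_
    simp [survival_zero]
  | succ i ih =>
    intro hi v hv t
    have hcard := card_walk_take_mem (k := k) hi {v} (by simpa using hv)
    have h := sum_survival_le (k := k) (U := {v}) (i := i) (q := ((d : ℝ) ^ (i + 1))⁻¹)
      (by omega) (by omega) (by positivity)
      (Finset.univ.filter fun w : Walk d k => (List.ofFn w).take (i + 1) ∈ ({v} : Finset (Vertex d)))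
      (fun w hw => take_dominated_step fun _ => (Finset.mem_filter.1 hw).2) ?_
      (by positivity) (ih (by omega)) t
    · refine h.trans ?_
      rw [one_div, inv_inv, pow_succ]
      nlinarith [pow_pos (by linarith : (0 : ℝ) < d) i]
    · rw [hcard]
      have h4 : (d : ℝ) ^ k = (d : ℝ) ^ (i + 1) * (d : ℝ) ^ (k - (i + 1)) := by
        rw [← pow_add]; congr 1; omega
      rw [h4]
      simp
      field_simp
      rfl

/-! ### Growth from level to level and the upper tail -/

/-- `U` consists of at least `x` vertices of level `k + 1 - j`. Level `k + 1` stands for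
`d ^ (k + 1)` copies of the sink, all of them occupied from the beginning. -/
def Frontier (k j : ℕ) (x : ℝ) (U : Finset (Vertex d)) : Prop :=
  (j = 0 ∧ x ≤ (d : ℝ) ^ (k + 1)) ∨
    (0 < j ∧ (∀ u ∈ U, u.length = k + 1 - j) ∧ x ≤ U.card)

/-- Counting the sink as $d^{k+1}$ occupied vertices makes the success probability $x/d^{k+1-j}$
valid for `j = 0` too, where every walk qualifies. -/
theorem Frontier.exists_walks (hd : 0 < d) {j : ℕ} (hj : j ≤ k) {x : ℝ} {U : Finset (Vertex d)}
    (h : Frontier k j x U) : ∃ H : Finset (Walk d k),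
      (∀ w ∈ H, Dominated {(List.ofFn w).take (k - j)} (step U w)) ∧
      x / (d : ℝ) ^ (k + 1 - j) * (d : ℝ) ^ k ≤ H.card := by
  have hd' : (0 : ℝ) < d := by positivity
  rcases Nat.eq_zero_or_pos j with rfl | hj0
  · refine ⟨Finset.univ, fun w _ => take_dominated_step fun h => absurd h (by simp), ?_⟩
    have hx : x ≤ (d : ℝ) ^ (k + 1) := by
      rcases h with h | h
      · exact h.2
      · omega
    have hle : x / (d : ℝ) ^ (k + 1 - 0) * (d : ℝ) ^ k ≤ 1 * (d : ℝ) ^ k := by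
      gcongr
      exact (div_le_one (by positivity)).2 hx
    simpa using hle
  · rcases h with h | ⟨-, hU, hx⟩
    · omega
    have hcard := card_walk_take_mem (k := k) (show k + 1 - j ≤ k by omega) U hU
    refine ⟨Finset.univ.filter fun w : Walk d k => (List.ofFn w).take (k + 1 - j) ∈ U,
      fun w hw => take_dominated_step fun _ => ?_, ?_⟩
    · rw [show k - j + 1 = k + 1 - j by omega]
      exact (Finset.mem_filter.1 hw).2
    · rw [hcard]
      have h4 : (d : ℝ) ^ k = (d : ℝ) ^ (k + 1 - j) * (d : ℝ) ^ (k - (k + 1 - j)) := by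
        rw [← pow_add]; congr 1; omega
      push_cast
      rw [h4, ← mul_assoc, div_mul_cancel₀ _ (by positivity)]
      gcongr

/-- If the numbers `N j` grow slowly enough, then `N j` vertices at level `k + 1 - j` produce
`N (j + 1)` vertices at the next level within `m` steps. -/
theorem survival_frontier_le (hd : 0 < d) {r m t : ℕ} (hr : r ≤ k) {N : ℕ → ℝ} {ε δ : ℝ}
    (hN : ∀ j < r, N (j + 1) ≤ N j / (2 * d))
    (hNm : ∀ j < r, N (j + 1) ≤ m * (N j / (d : ℝ) ^ (k + 1 - j)) / 8)
    (hδ : ∀ j, Real.exp (-N j) ≤ δ) (hε : 0 ≤ ε)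
    (h : ∀ U : Finset (Vertex d), Frontier k r (N r) U → survival k t U ≤ ε) :
    ∀ i ≤ r, ∀ U : Finset (Vertex d), Frontier k (r - i) (N (r - i)) U →
      survival k (t + i * m) U ≤ ε + i * δ := by
  have hd' : (0 : ℝ) < d := by positivity
  have hδ0 : 0 ≤ δ := (Real.exp_pos _).le.trans (hδ 0)
  intro i
  induction i with
  | zero => intro _ U hU; simpa using h U hU
  | succ i ih =>
    intro hi U hU
    obtain ⟨j, hj⟩ : ∃ j, r - (i + 1) = j := ⟨_, rfl⟩
    have hj1 : r - i = j + 1 := by omega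
    rw [hj] at hU
    rw [hj1] at ih
    obtain ⟨H, hH, hcard⟩ := hU.exists_walks hd (show j ≤ k by omega)
    have hstep := survival_add_le (t := t + i * m) (m := m) (N := N (j + 1)) (M := ε + i * δ) hd
      (Nat.sub_le k j) H hH hcard ?_ (hNm j (by omega))
      (by positivity)
      (fun D hD hDc => ih (by omega) D (Or.inr ⟨by omega, by simpa using hD, hDc⟩))
    · rw [show t + (i + 1) * m = t + i * m + m by ring]
      push_cast
      linarith [hδ (j + 1)]
    · refine (hN j (by omega)).trans_eq ?_
      rw [show k + 1 - j = (k - j) + 1 by omega, pow_succ]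
      field_simp

/-- Survival is nonincreasing in time, so `t` times its value is at most the truncated expected
remaining time: a wait for level `k - r`, then a climb from there. -/
theorem survival_frontier_last_le (hd : 2 ≤ d) {r t : ℕ} (hr : r ≤ k) (ht : 0 < t) {x : ℝ}
    (hx : 0 < x) {U : Finset (Vertex d)} (hU : Frontier k r x U) :
    survival k t U ≤ ((d : ℝ) ^ (k + 1 - r) / x + 2 * (d : ℝ) ^ (k - r)) / t := by
  have hd' : (0 : ℝ) < d := by positivity
  have ht' : (0 : ℝ) < t := by exact_mod_cast ht
  obtain ⟨H, hH, hcard⟩ := hU.exists_walks (by omega) hr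
  have h := sum_survival_le (by omega) (Nat.sub_le k r) (by positivity) H hH hcard
    (by positivity) (sum_survival_singleton_le hd (k - r) (Nat.sub_le k r)) t
  rw [one_div_div] at h
  rw [le_div_iff₀ ht']
  refine le_trans ?_ h
  calc survival k t U * t = ∑ s ∈ Finset.range t, survival k t U := by simp [mul_comm]
    _ ≤ _ := Finset.sum_le_sum fun s hs =>
      survival_antitone (by omega) U (Finset.mem_range.1 hs).le

/-- From $e^z\ge z^5/5!$. -/
theorem mul_exp_neg_le {x z : ℝ} (hz : 0 < z) (hx : x ≤ z ^ 4) :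
    x * Real.exp (-z) ≤ 120 / z := by
  have h5 := Real.pow_div_factorial_le_exp z hz.le 5
  have h : z ^ 5 / 120 ≤ Real.exp z := by simpa [Nat.factorial] using h5
  rw [Real.exp_neg, ← div_eq_mul_inv, div_le_div_iff₀ (Real.exp_pos _) hz]
  calc x * z ≤ z ^ 4 * z := by gcongr
    _ = 120 * (z ^ 5 / 120) := by ring
    _ ≤ 120 * Real.exp z := by gcongr

/-- The level at which the growth of the aggregate stops being the bottleneck. -/
theorem exists_level_near (hd : 2 ≤ d) (hk : 1 ≤ k) : ∃ r ≤ k,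
    (r : ℝ) + 1 ≤ √(2 * (k : ℝ) + 2) ∧
    (∀ j < r, 2 * (d : ℝ) ^ ((k : ℝ) + 2 - √(2 * (k : ℝ) + 2)) ≤ (d : ℝ) ^ (k - j)) ∧
    (d : ℝ) ^ (k - r) ≤ 2 * (d : ℝ) ^ ((k : ℝ) + 2 - √(2 * (k : ℝ) + 2)) := by
  set S := √(2 * (k : ℝ) + 2) with hS
  set P := (d : ℝ) ^ ((k : ℝ) + 2 - S) with hP
  have hS2 : 2 ≤ S := two_le_sqrt hk
  have hSk : S ≤ k + 1 := sqrt_le_add_one hk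
  have hd2 : (2 : ℝ) ≤ d := by exact_mod_cast hd
  have hd0 : (0 : ℝ) < d := by linarith
  have hd1 : (1 : ℝ) ≤ d := by linarith
  have hP0 : 0 < P := by positivity
  have hdS : (2 : ℝ) * d ≤ (d : ℝ) ^ S := by
    calc (2 : ℝ) * d ≤ d * d := by gcongr
      _ = (d : ℝ) ^ (2 : ℝ) := by rw [Real.rpow_two]; ring
      _ ≤ _ := Real.rpow_le_rpow_of_exponent_le hd1 hS2
  -- The largest `r` with $2d\cdot d^r\le d^S$. As $P d^S=d^{k+2}$, this says $d^{k-r}<2P\le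
  -- d^{k-r+1}$.
  obtain ⟨r, hr1, hr2⟩ := exists_nat_pow_near (x := (d : ℝ) ^ S / (2 * d)) (y := (d : ℝ))
    ((one_le_div (by positivity)).2 hdS) (by linarith)
  rw [le_div_iff₀ (by positivity)] at hr1
  rw [div_lt_iff₀ (by positivity)] at hr2
  have hPS : P * (d : ℝ) ^ S = (d : ℝ) ^ (k + 2) := by
    rw [hP, ← Real.rpow_add hd0, ← Real.rpow_natCast]
    congr 1
    push_cast
    ring
  have hrS : (r : ℝ) + 1 ≤ S := by
    have h1 : (d : ℝ) ^ ((r : ℝ) + 1) ≤ (d : ℝ) ^ S := by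
      rw [← Nat.cast_add_one, Real.rpow_natCast]
      refine le_trans ?_ hr1
      rw [pow_succ]
      gcongr
      linarith
    exact (Real.rpow_le_rpow_left_iff (by linarith)).1 h1
  have hrk : r ≤ k := by
    have : (r : ℝ) ≤ k := by linarith
    exact_mod_cast this
  have hPr : ∀ j < r, 2 * P ≤ (d : ℝ) ^ (k - j) := by
    intro j hj
    have h1 : (d : ℝ) ^ (k - r + 1) ≤ (d : ℝ) ^ (k - j) :=
      pow_le_pow_right₀ hd1 (by omega)
    refine le_trans ?_ h1
    have h2 : P * ((d : ℝ) ^ r * (2 * d)) ≤ (d : ℝ) ^ (k + 2) := by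
      rw [← hPS]
      gcongr
    have h3 : (d : ℝ) ^ (k + 2) = (d : ℝ) ^ (k - r + 1) * ((d : ℝ) ^ r * d) := by
      rw [← pow_succ, ← pow_add]; congr 1; omega
    rw [h3] at h2
    have h4 : 0 < (d : ℝ) ^ r * d := by positivity
    refine le_of_mul_le_mul_right ?_ h4
    linarith
  have hkr : (d : ℝ) ^ (k - r) ≤ 2 * P := by
    have h2 : (d : ℝ) ^ (k + 2) ≤ P * ((d : ℝ) ^ (r + 1) * (2 * d)) := by
      rw [← hPS]
      gcongr
    have h3 : (d : ℝ) ^ (k + 2) = (d : ℝ) ^ (k - r) * ((d : ℝ) ^ (r + 1) * d) := by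
      rw [← pow_succ, ← pow_add]; congr 1; omega
    rw [h3] at h2
    have h4 : 0 < (d : ℝ) ^ (r + 1) * d := by positivity
    refine le_of_mul_le_mul_right ?_ h4
    linarith
  exact ⟨r, hrk, hrS, hPr, hkr⟩

/-- The finish time is unlikely to be much larger than `√k * d ^ (k + 2 - √(2k+2))`. -/
theorem survival_empty_le (hd : 2 ≤ d) (hk : 1 ≤ k) {y : ℝ} (hy : 38 ≤ y) :
    survival k ⌊y * (√(k : ℝ) * (d : ℝ) ^ ((k : ℝ) + 2 - √(2 * (k : ℝ) + 2)))⌋₊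
      (∅ : Finset (Vertex d)) ≤ 10 / y + 120 / (d : ℝ) ^ (√(k : ℝ) / 4) := by
  set S := √(2 * (k : ℝ) + 2) with hS
  set P := (d : ℝ) ^ ((k : ℝ) + 2 - S) with hP
  have hS2 : 2 ≤ S := two_le_sqrt hk
  have hSk : S ≤ k + 1 := sqrt_le_add_one hk
  have hSsq : S ^ 2 = 2 * k + 2 := sq_sqrt_two_mul_add_two k
  have hSk' : √(k : ℝ) ≤ S := sqrt_le_sqrt_two_mul_add_two k
  have hk1 : (1 : ℝ) ≤ k := by exact_mod_cast hk
  have hsk1 : 1 ≤ √(k : ℝ) := Real.one_le_sqrt.2 hk1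
  have hS2k : S ≤ 2 * √(k : ℝ) := by
    rw [hS, Real.sqrt_le_left (by positivity), mul_pow, Real.sq_sqrt (by positivity)]
    linarith
  have hd2 : (2 : ℝ) ≤ d := by exact_mod_cast hd
  have hd0 : (0 : ℝ) < d := by linarith
  have hd1 : (1 : ℝ) ≤ d := by linarith
  have hP1 : 1 ≤ P := Real.one_le_rpow hd1 (by linarith)
  obtain ⟨r, hrk, hrS, hPr, hkr⟩ := exists_level_near hd hk
  rw [← hS, ← hP] at hPr hkr
  rw [← hS] at hrS
  -- The solution of $N_{j+1}=N_jP/d^{k+1-j}$ with $N_0=d^{S^2/2}=d^{k+1}$, the virtual sinks.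
  set N : ℕ → ℝ := fun j => (d : ℝ) ^ (((j : ℝ) - S) ^ 2 / 2 + j / 2) with hN
  have hNpos : ∀ j, 0 < N j := fun j => by positivity
  have hNsucc : ∀ j ≤ k, N (j + 1) = N j * P / (d : ℝ) ^ (k + 1 - j) := by
    intro j hj
    rw [hN, ← Real.rpow_natCast, hP, ← Real.rpow_add hd0, ← Real.rpow_sub hd0]
    simp only
    congr 1
    rw [Nat.cast_sub (by omega)]
    push_cast
    ring
  set z := (d : ℝ) ^ (S / 4) with hz
  have hz0 : 0 < z := by positivity
  have hzN : ∀ j, z ≤ N j := by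
    intro j
    refine Real.rpow_le_rpow_of_exponent_le hd1 ?_
    -- The exponent of $N_j$ is $(j-S+1/2)^2/2+S/2-1/8$, and $S\ge2$.
    nlinarith [sq_nonneg ((j : ℝ) - S + 1 / 2)]
  set m := ⌈8 * P⌉₊ with hm
  have hm1 : 8 * P ≤ m := Nat.le_ceil _
  have hm2 : (m : ℝ) ≤ 9 * P := by
    have := (Nat.ceil_lt_add_one (by positivity : 0 ≤ 8 * P)).le
    linarith
  set W := y * (√(k : ℝ) * P) with hW
  have hsP : 1 ≤ √(k : ℝ) * P := one_le_mul_of_one_le_of_one_le hsk1 hP1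
  have hrm : (r : ℝ) * m ≤ 18 * (√(k : ℝ) * P) := by
    calc (r : ℝ) * m ≤ (2 * √(k : ℝ)) * (9 * P) := by gcongr; linarith
      _ = _ := by ring
  have hfloor := Nat.lt_floor_add_one W
  -- The phases use at most $18\sqrt k P$ and the floor at most $1\le\sqrt kP$, so $y\ge38=2\cdot19$
  -- leaves half of the time.
  have hτ : y / 2 * P ≤ (⌊W⌋₊ : ℝ) - r * m := by
    have h1 : y / 2 * P ≤ y / 2 * (√(k : ℝ) * P) := by
      gcongr
      nlinarith
    nlinarith
  have hτpos : 0 < y / 2 * P := by positivity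
  have hle : r * m ≤ ⌊W⌋₊ := by
    have : ((r * m : ℕ) : ℝ) ≤ ⌊W⌋₊ := by push_cast; linarith
    exact_mod_cast this
  obtain ⟨t, ht⟩ := Nat.exists_eq_add_of_le' hle
  have ht' : (t : ℝ) = (⌊W⌋₊ : ℝ) - r * m := by rw [ht]; push_cast; ring
  rw [← ht'] at hτ
  have htpos : 0 < t := by
    have : (0 : ℝ) < t := by linarith
    exact_mod_cast this
  have hlast : ∀ U : Finset (Vertex d), Frontier k r (N r) U → survival k t U ≤ 10 / y := by
    intro U hU
    refine (survival_frontier_last_le hd hrk htpos (hNpos r) hU).trans ?_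
    have h1 : (d : ℝ) ^ (k + 1 - r) / N r ≤ P := by
      rw [hN, ← Real.rpow_natCast, ← Real.rpow_sub hd0]
      refine Real.rpow_le_rpow_of_exponent_le hd1 ?_
      rw [Nat.cast_sub (by omega)]
      push_cast
      nlinarith [sq_nonneg (S - r - 1), (Nat.cast_nonneg r : (0 : ℝ) ≤ r)]
    calc ((d : ℝ) ^ (k + 1 - r) / N r + 2 * (d : ℝ) ^ (k - r)) / t
        ≤ (5 * P) / (y / 2 * P) := by gcongr; linarith
      _ = 10 / y := by field_simp; norm_num
  have hmain := survival_frontier_le (k := k) (d := d) (r := r) (m := m) (t := t) (N := N)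
    (ε := 10 / y) (δ := Real.exp (-z)) (by omega) hrk ?_ ?_
    (fun j => Real.exp_le_exp.2 (neg_le_neg (hzN j))) (by positivity) hlast r le_rfl ∅ ?_
  · rw [ht]
    refine hmain.trans ?_
    have hz4 : (r : ℝ) ≤ z ^ 4 := by
      have h1 : z ^ 4 = (d : ℝ) ^ S := by
        rw [hz, ← Real.rpow_mul_natCast hd0.le]
        congr 1
        push_cast
        ring
      have h2 : (d : ℝ) ^ r ≤ (d : ℝ) ^ S := by
        rw [← Real.rpow_natCast]
        exact Real.rpow_le_rpow_of_exponent_le hd1 (by linarith)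
      have h3 : (r : ℝ) ≤ (d : ℝ) ^ r := by
        exact_mod_cast (Nat.lt_pow_self (by omega : 1 < d)).le
      rw [h1]
      exact h3.trans h2
    have hexp := mul_exp_neg_le hz0 hz4
    have hzk : 120 / z ≤ 120 / (d : ℝ) ^ (√(k : ℝ) / 4) := by
      gcongr
      exact Real.rpow_le_rpow_of_exponent_le hd1 (by linarith)
    linarith
  · intro j hj
    rw [hNsucc j (by omega), show k + 1 - j = (k - j) + 1 by omega, pow_succ]
    rw [div_le_div_iff₀ (by positivity) (by positivity)]
    calc N j * P * (2 * d) = N j * d * (2 * P) := by ring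
      _ ≤ N j * d * (d : ℝ) ^ (k - j) :=
        mul_le_mul_of_nonneg_left (hPr j hj) (mul_nonneg (hNpos j).le hd0.le)
      _ = _ := by ring
  · intro j hj
    rw [hNsucc j (by omega)]
    have h1 : 0 ≤ N j / (d : ℝ) ^ (k + 1 - j) := div_nonneg (hNpos j).le (by positivity)
    have h2 : N j * P / (d : ℝ) ^ (k + 1 - j) = (8 * P) * (N j / (d : ℝ) ^ (k + 1 - j)) / 8 := by
      ring
    rw [h2]
    gcongr
  · refine Or.inl ⟨by simp, ?_⟩
    rw [Nat.sub_self, hN, ← Real.rpow_natCast]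
    refine Real.rpow_le_rpow_of_exponent_le hd1 ?_
    push_cast
    nlinarith

theorem walkLaw_lt_finishTime_le (hd : 2 ≤ d) (hk : 1 ≤ k) {y : ℝ} (hy : 38 ≤ y) :
    walkLaw d k {ρ | y * (d : ℝ) ^ (1 / 2 : ℝ) * timeScale d k < (finishTime ρ : ℝ)} ≤
      ENNReal.ofReal (10 / y + 120 / (d : ℝ) ^ (√(k : ℝ) / 4)) := by
  have hd0 : (0 : ℝ) < d := by positivity
  have hW : y * (d : ℝ) ^ (1 / 2 : ℝ) * timeScale d k =
      y * (√(k : ℝ) * (d : ℝ) ^ ((k : ℝ) + 2 - √(2 * (k : ℝ) + 2))) := by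
    rw [timeScale, show (k : ℝ) + 2 - √(2 * (k : ℝ) + 2) =
      1 / 2 + ((k : ℝ) + 3 / 2 - √(2 * (k : ℝ) + 2)) by ring, Real.rpow_add hd0]
    ring
  rw [hW]
  refine le_trans ?_ (ENNReal.ofReal_le_ofReal (survival_empty_le hd hk hy))
  refine walkLaw_occupied_le (by omega) _ (fun C => by split_ifs <;> norm_num) fun ρ hρ => ?_
  have hlt : y * (√(k : ℝ) * (d : ℝ) ^ ((k : ℝ) + 2 - √(2 * (k : ℝ) + 2))) < finishTime ρ := hρ
  have hnot : [] ∉ occupied ρ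
      ⌊y * (√(k : ℝ) * (d : ℝ) ^ ((k : ℝ) + 2 - √(2 * (k : ℝ) + 2)))⌋₊ := by
    rw [← finishTime_le_iff, not_le]
    exact (Nat.floor_lt (by positivity)).2 hlt
  simp [hnot]

/-! ### Rounding loss and passage to the limit -/

theorem walkLaw_finishTime_lt_le_div (hd : 2 ≤ d) (hk : 1 ≤ k) {y g : ℝ} (hg : 0 < g)
    (hy : 6 * g ≤ y)
    (h : (d : ℝ) ^ ((⌊√(2 * (k : ℝ) + 2)⌋₊ - √(2 * (k : ℝ) + 2)) ^ 2 / 2) ≤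
      g ^ ⌊√(2 * (k : ℝ) + 2)⌋₊) :
    walkLaw d k {ρ | (finishTime ρ : ℝ) < timeScale d k / y} ≤ ENNReal.ofReal (6 * g / y) := by
  have hy0 : 0 < y := by linarith
  refine (walkLaw_finishTime_lt_le hd hk hy0).trans (ENNReal.ofReal_le_ofReal ?_)
  have hs : ⌊√(2 * (k : ℝ) + 2)⌋₊ ≠ 0 := by
    have : 2 ≤ ⌊√(2 * (k : ℝ) + 2)⌋₊ := Nat.le_floor (two_le_sqrt hk)
    omega
  refine (mul_le_mul_of_nonneg_left h (by positivity)).trans ?_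
  rw [← mul_pow, div_mul_eq_mul_div]
  exact pow_le_of_le_one (by positivity) ((div_le_one hy0).2 hy) hs

/-- Rounding `√(2k+2)` to an integer costs at most a factor `d ^ (1 / √k)` in the time scale. -/
theorem rpow_floor_sub_sq_le (hd : 2 ≤ d) (hk : 1 ≤ k) :
    (d : ℝ) ^ ((⌊√(2 * (k : ℝ) + 2)⌋₊ - √(2 * (k : ℝ) + 2)) ^ 2 / 2) ≤
      ((d : ℝ) ^ (1 / √(k : ℝ))) ^ ⌊√(2 * (k : ℝ) + 2)⌋₊ := by
  have hd1 : (1 : ℝ) ≤ d := by exact_mod_cast (by omega : 1 ≤ d)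
  rw [← Real.rpow_mul_natCast (by positivity)]
  refine Real.rpow_le_rpow_of_exponent_le hd1 ?_
  have hk0 : 0 < √(k : ℝ) := Real.sqrt_pos.2 (by exact_mod_cast hk)
  -- The rounding error is below $1$, so the exponent on the left is at most $1/2$.
  have h1 : 1 / 2 ≤ 1 / √(k : ℝ) * (⌊√(2 * (k : ℝ) + 2)⌋₊ : ℝ) := by
    rw [div_mul_eq_mul_div, one_mul, le_div_iff₀ hk0]
    linarith [sqrt_le_two_mul_floor hk]
  have h2 := Nat.floor_le (Real.sqrt_nonneg (2 * (k : ℝ) + 2))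
  have h3 := Nat.lt_floor_add_one √(2 * (k : ℝ) + 2)
  nlinarith

/-- As $\log d\ge\log2$, $\sqrt k\log d\ge\sqrt{\log2\cdot\log n}$, so $n\to\infty$ suffices whether
it is `d` or `k` that grows. -/
theorem tendsto_rpow_sqrt_div_four {d k : ℕ → ℕ} (hd : ∀ m, 2 ≤ d m)
    (hn : Tendsto (fun m => d m ^ k m) atTop atTop) :
    Tendsto (fun m => (d m : ℝ) ^ (√(k m : ℝ) / 4)) atTop atTop := by
  have hn' : Tendsto (fun m => ((d m ^ k m : ℕ) : ℝ)) atTop atTop :=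
    tendsto_natCast_atTop_atTop.comp hn
  have hlog2 : 0 < Real.log 2 := Real.log_pos (by norm_num)
  have h1 : Tendsto (fun m => Real.exp (√(Real.log 2 * Real.log ((d m ^ k m : ℕ) : ℝ)) / 4))
      atTop atTop :=
    Real.tendsto_exp_atTop.comp ((Real.tendsto_sqrt_atTop.comp
      ((Real.tendsto_log_atTop.comp hn').const_mul_atTop hlog2)).atTop_div_const (by norm_num))
  refine tendsto_atTop_mono (fun m => ?_) h1
  have hd2 : (2 : ℝ) ≤ d m := by exact_mod_cast hd m
  have hlog : Real.log 2 ≤ Real.log (d m) := Real.log_le_log (by norm_num) hd2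
  rw [Real.rpow_def_of_pos (by linarith), ← mul_div_assoc]
  refine Real.exp_le_exp.2 (div_le_div_of_nonneg_right ?_ (by norm_num))
  rw [Real.sqrt_le_left (mul_nonneg (by linarith) (Real.sqrt_nonneg _)), mul_pow,
    Real.sq_sqrt (by positivity)]
  push_cast
  rw [Real.log_pow]
  have : 0 ≤ (k m : ℝ) * Real.log (d m) := mul_nonneg (by positivity) (by linarith)
  nlinarith

theorem eventually_one_le_height {d k : ℕ → ℕ} (hn : Tendsto (fun m => d m ^ k m) atTop atTop) :
    ∀ᶠ m in atTop, 1 ≤ k m := by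
  filter_upwards [hn.eventually_ge_atTop 2] with m hm
  by_contra! h
  rw [Nat.lt_one_iff.1 h] at hm
  simp at hm

theorem tendsto_walkLaw {d k : ℕ → ℕ} {om y e : ℕ → ℝ} (hd : ∀ m, 2 ≤ d m)
    (hn : Tendsto (fun m => d m ^ k m) atTop atTop) (hom : Tendsto om atTop atTop)
    (he : Tendsto e atTop (𝓝 0))
    (hlow : ∀ᶠ m in atTop, walkLaw (d m) (k m)
      {ρ | (finishTime ρ : ℝ) < timeScale (d m) (k m) / y m} ≤ ENNReal.ofReal (e m)) :
    Tendsto (fun m => walkLaw (d m) (k m)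
      {ρ | timeScale (d m) (k m) / y m ≤ (finishTime ρ : ℝ) ∧
        (finishTime ρ : ℝ) ≤ om m * (d m : ℝ) ^ (1 / 2 : ℝ) * timeScale (d m) (k m)})
      atTop (𝓝 1) := by
  have hup : Tendsto (fun m => 10 / om m + 120 / (d m : ℝ) ^ (√(k m : ℝ) / 4)) atTop (𝓝 0) := by
    simpa using (tendsto_const_nhds.div_atTop hom).add
      (tendsto_const_nhds.div_atTop (tendsto_rpow_sqrt_div_four hd hn))
  have hprob : ∀ m, IsProbabilityMeasure (walkLaw (d m) (k m)) := fun m => by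
    have : Nonempty (Fin (d m)) := ⟨⟨0, by have := hd m; omega⟩⟩
    unfold walkLaw
    infer_instance
  have hlim : Tendsto (fun m => 1 - (ENNReal.ofReal (e m) +
      ENNReal.ofReal (10 / om m + 120 / (d m : ℝ) ^ (√(k m : ℝ) / 4)))) atTop (𝓝 1) := by
    have h := (ENNReal.tendsto_ofReal he).add (ENNReal.tendsto_ofReal hup)
    simpa using ENNReal.Tendsto.sub (tendsto_const_nhds (x := (1 : ENNReal))) h (by simp)
  refine tendsto_of_tendsto_of_tendsto_of_le_of_le' hlim tendsto_const_nhds ?_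
    (.of_forall fun m => prob_le_one)
  filter_upwards [hlow, hom.eventually_ge_atTop 38, eventually_one_le_height hn] with m h1 h2 h3
  rw [tsub_le_iff_right, ← (hprob m).measure_univ]
  refine le_trans ?_ (add_le_add le_rfl
    (add_le_add h1 (walkLaw_lt_finishTime_le (hd m) h3 h2)))
  refine le_trans (measure_mono ?_) ((measure_union_le _ _).trans
    (add_le_add le_rfl (measure_union_le _ _)))
  intro ρ _
  by_cases ha : (finishTime ρ : ℝ) < timeScale (d m) (k m) / y m
  · exact Or.inr (Or.inl ha)
  by_cases hb : om m * (d m : ℝ) ^ (1 / 2 : ℝ) * timeScale (d m) (k m) < (finishTime ρ : ℝ)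
  · exact Or.inr (Or.inr hb)
  exact Or.inl ⟨not_lt.1 ha, not_lt.1 hb⟩

end DLA

theorem mainTheorem3 :
    (∀ (d k : ℕ → ℕ) (om : ℕ → ℝ) (B : ℝ), (∀ m, 2 ≤ d m) →
      Tendsto (fun m => d m ^ k m) atTop atTop → Tendsto om atTop atTop →
      (∀ m, (d m : ℝ) ^ (1 / √(k m : ℝ)) ≤ B ∨ IsSquare (2 * k m + 2)) →
      Tendsto (fun m => DLA.walkLaw (d m) (k m)
          {ρ | DLA.timeScale (d m) (k m) / om m ≤ (DLA.finishTime ρ : ℝ) ∧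
            (DLA.finishTime ρ : ℝ) ≤
              om m * (d m : ℝ) ^ (1 / 2 : ℝ) * DLA.timeScale (d m) (k m)})
        atTop (𝓝 1)) ∧
    (∃ A : ℝ, 0 < A ∧ ∀ (d k : ℕ → ℕ) (om : ℕ → ℝ), (∀ m, 2 ≤ d m) →
      Tendsto (fun m => d m ^ k m) atTop atTop → Tendsto om atTop atTop →
      Tendsto (fun m => DLA.walkLaw (d m) (k m)
          {ρ | DLA.timeScale (d m) (k m) / (om m * (d m : ℝ) ^ (A / √(k m : ℝ))) ≤
              (DLA.finishTime ρ : ℝ) ∧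
            (DLA.finishTime ρ : ℝ) ≤
              om m * (d m : ℝ) ^ (1 / 2 : ℝ) * DLA.timeScale (d m) (k m)})
        atTop (𝓝 1)) := by
  -- $A=1$ suffices: it is the exponent in `rpow_floor_sub_sq_le`.
  refine ⟨fun d k om B hd hn hom hB => ?_, 1, one_pos, fun d k om hd hn hom => ?_⟩
  · refine DLA.tendsto_walkLaw hd hn hom
      ((tendsto_const_nhds (x := 6 * max B 1)).div_atTop hom) ?_
    filter_upwards [hom.eventually_ge_atTop (6 * max B 1),
      DLA.eventually_one_le_height hn] with m h1 h2
    refine DLA.walkLaw_finishTime_lt_le_div (hd m) h2 (by positivity) h1 ?_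
    rcases hB m with hBm | ⟨c, hc⟩
    · refine (DLA.rpow_floor_sub_sq_le (hd m) h2).trans ?_
      gcongr
      exact hBm.trans (le_max_left _ _)
    -- There is no rounding loss here; the maximum with $1$ makes the allowance $g^{\lfloor
    -- S\rfloor}$ at least $1$.
    · have hS : √(2 * (k m : ℝ) + 2) = c := by
        rw [show 2 * (k m : ℝ) + 2 = (c : ℝ) * c by exact_mod_cast hc,
          Real.sqrt_mul_self (by positivity)]
      rw [hS, Nat.floor_natCast]
      simpa using one_le_pow₀ (le_max_right B 1)
  · refine DLA.tendsto_walkLaw hd hn hom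
      ((tendsto_const_nhds (x := (6 : ℝ))).div_atTop hom) ?_
    filter_upwards [hom.eventually_ge_atTop 6, DLA.eventually_one_le_height hn] with m h1 h2
    have hd0 : (0 : ℝ) < d m := by exact_mod_cast (by have := hd m; omega : 0 < d m)
    have hg : 0 < (d m : ℝ) ^ (1 / √(k m : ℝ)) := by positivity
    have h := DLA.walkLaw_finishTime_lt_le_div (hd m) h2 hg
      (mul_le_mul_of_nonneg_right h1 hg.le) (DLA.rpow_floor_sub_sq_le (hd m) h2)
    rwa [mul_div_mul_right _ _ hg.ne'] at h
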